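/- A spacetime on $\mathbb{R}^4$ is a smooth Lorentzian metric $g_{\mu\nu}$, of signature $(-,+,+,+)$, on $\mathbb{R}^4$; a vacuum solution is one whose Einstein tensor vanishes ($\Lambda=0$). Write $\widetilde g\simeq_{\mathrm{diff}} g$ if $g=\varphi^*\widetilde g$ for some smooth diffeomorphism $\varphi$ of $\mathbb{R}^4$, and give sets of spacetimes the $C^\infty$ compact-open topology and its Borel sets. A Polish $G$-space $X$ (a continuous action of a Polish group $G$ on a Polish space $X$) is generically ergodic if some orbit is dense and every orbit is meager. A family $\mathcal S$ of spacetimes is rich if there are a generically ergodic Polish $G$-space $X$ and a Borel reduction from its orbit equivalence relation $\simeq_G$ to $\simeq_{\mathrm{diff}}$ on $\mathcal S$, that is, a Borel map $r\colon X\to\mathcal S$ with $\alpha\simeq_G\beta\iff r(\alpha)\simeq_{\mathrm{diff}}r(\beta)$ for all $\alpha,\beta\in X$. **Theorem.** The vacuum solutions on $\mathbb{R}^4$ form a rich family. More precisely: 1. The Bernoulli shift $\mathbb{Z}\curvearrowright\{0,1\}^{\mathbb{Z}}$, $(k\cdot\alpha)(n)=\alpha(n-k)$, is a generically ergodic Polish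 $\mathbb{Z}$-space. 2. There are smooth functions $W\colon\mathbb{R}\to[0,1]$ which vanish outside $[0,1]$, take the value $1$ at exactly one point, that point being less than $1/2$, and whose graph is not symmetric about any vertical axis. 3. Let $W$ be any such function, and for $\alpha\in\{0,1\}^{\mathbb{Z}}$ put $W_\alpha(u)=2+W(u-\lfloor u\rfloor)$ if $\alpha(\lfloor u\rfloor)=1$ and $W_\alpha(u)=2-W(u-\lfloor u\rfloor)$ if $\alpha(\lfloor u\rfloor)=0$. Then the gravitational plane wave in Brinkmann form $$r(\alpha)=W_\alpha(u)\,xy\,du^2+du\,dv+dx^2+dy^2$$ is a vacuum solution on $\mathbb{R}^4$, the map $r$ is continuous, and it is a Borel reduction: $\beta=k\cdot\alpha$ for some $k\in\mathbb{Z}$ if and only if $r(\alpha)\simeq_{\mathrm{diff}}r(\beta)$. -/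

import Mathlib

open scoped ContDiff Manifold

noncomputable section

/-! ### Spacetimes on `ℝ⁴` -/

/-- The manifold `ℝ⁴`, with its global coordinates `x⁰, x¹, x², x³`. -/
abbrev R4 : Type := Fin 4 → ℝ

/-- The components `g_{μν}` of a bilinear form on `ℝ⁴`. -/
abbrev Components : Type := Fin 4 → Fin 4 → ℝ

/-- A bilinear form has Lorentzian signature `(-, +, +, +)`: it is symmetric, and in a suitable
basis (the columns of `P`) its matrix is `diag(-1, 1, 1, 1)`. -/
def IsLorentzian (A : Components) : Prop :=
  (∀ μ ν, A μ ν = A ν μ) ∧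
    ∃ P : Matrix (Fin 4) (Fin 4) ℝ, IsUnit P.det ∧
      P.transpose * Matrix.of A * P = Matrix.diagonal ![-1, 1, 1, 1]

/-- A smooth spacetime supported on `ℝ⁴`: a smooth field of Lorentzian metrics `g_{μν}`. -/
@[ext]
structure Spacetime where
  /-- The components `g_{μν}(x)`. -/
  metric : R4 → Components
  smooth : ContDiff ℝ ∞ metric
  lorentzian : ∀ x, IsLorentzian (metric x)

/-- The `n`-th derivative of the metric, as a continuous map on `ℝ⁴`. -/
def Spacetime.jet (n : ℕ) (g : Spacetime) :
    C(R4, ContinuousMultilinearMap ℝ (fun _ : Fin n => R4) Components) where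
  toFun := iteratedFDeriv ℝ n g.metric
  continuous_toFun := g.smooth.continuous_iteratedFDeriv (by exact_mod_cast le_top)

/-- The `C^∞` compact-open topology: uniform convergence on compact sets of the metric components
together with their derivatives of every order. -/
instance : TopologicalSpace Spacetime :=
  ⨅ n : ℕ, TopologicalSpace.induced (Spacetime.jet n) inferInstance

/-- The partial derivative `∂f/∂x^μ`. -/
def partialDeriv (μ : Fin 4) (f : R4 → ℝ) (x : R4) : ℝ :=
  fderiv ℝ f x (Pi.single μ 1)

/-- `g' ≃_diff g`: there is a smooth change of coordinates `φ` of `ℝ⁴` with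
`g_{μν}(x) = ∂φ^ρ/∂x^μ ∂φ^σ/∂x^ν g'_{ρσ}(φ x)`. -/
def DiffEquivalent (g' g : Spacetime) : Prop :=
  ∃ φ : Diffeomorph 𝓘(ℝ, R4) 𝓘(ℝ, R4) R4 R4 ∞, ∀ (x : R4) (μ ν : Fin 4),
    g.metric x μ ν = ∑ ρ, ∑ σ,
      partialDeriv μ (fun y => φ y ρ) x * partialDeriv ν (fun y => φ y σ) x *
        g'.metric (φ x) ρ σ

/-! ### Curvature and the vacuum equation -/

namespace Spacetime

variable (g : Spacetime)

/-- The inverse metric `g^{μν}`. -/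
def inverse (x : R4) (μ ν : Fin 4) : ℝ :=
  (Matrix.of (g.metric x))⁻¹ μ ν

/-- The Christoffel symbols `Γ^l_{μν}` of the Levi-Civita connection. -/
def christoffel (l μ ν : Fin 4) (x : R4) : ℝ :=
  (1 / 2) * ∑ s, g.inverse x l s *
    (partialDeriv μ (fun y => g.metric y ν s) x + partialDeriv ν (fun y => g.metric y μ s) x
      - partialDeriv s (fun y => g.metric y μ ν) x)

/-- The Ricci tensor
`R_{μν} = ∂_l Γ^l_{μν} - ∂_ν Γ^l_{lμ} + Γ^l_{ls} Γ^s_{μν} - Γ^l_{νs} Γ^s_{lμ}`. -/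
def ricci (μ ν : Fin 4) (x : R4) : ℝ :=
  ∑ l, (partialDeriv l (g.christoffel l μ ν) x - partialDeriv ν (g.christoffel l l μ) x)
    + ∑ l, ∑ s, (g.christoffel l l s x * g.christoffel s μ ν x
      - g.christoffel l ν s x * g.christoffel s l μ x)

/-- The scalar curvature `R = g^{μν} R_{μν}`. -/
def scalarCurvature (x : R4) : ℝ :=
  ∑ μ, ∑ ν, g.inverse x μ ν * g.ricci μ ν x

/-- The Einstein tensor `G_{μν} = R_{μν} - R g_{μν} / 2`. -/
def einstein (μ ν : Fin 4) (x : R4) : ℝ :=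
  g.ricci μ ν x - (1 / 2) * g.scalarCurvature x * g.metric x μ ν

end Spacetime

/-- The vacuum solutions on `ℝ⁴`: the spacetimes that satisfy Einstein's equation with vanishing
stress-energy tensor and vanishing cosmological constant. -/
def vacuumSolutions : Set Spacetime :=
  {g | ∀ x μ ν, g.einstein μ ν x = 0}

/-! ### Generic ergodicity and rich families -/

/-- `G` is a Polish group that acts continuously on the Polish space `X`. -/
structure IsPolishGSpace (G X : Type) [Group G] [TopologicalSpace G] [TopologicalSpace X]
    [MulAction G X] : Prop where
  topologicalGroup : IsTopologicalGroup G
  polishGroup : PolishSpace G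
  polishSpace : PolishSpace X
  continuous_smul : ContinuousSMul G X

/-- A Polish `G`-space is generically ergodic if some orbit is dense and every orbit is meager. -/
structure IsGenericallyErgodic (G X : Type) [Group G] [TopologicalSpace G] [TopologicalSpace X]
    [MulAction G X] : Prop extends IsPolishGSpace G X where
  exists_dense_orbit : ∃ x : X, Dense (MulAction.orbit G x)
  meager_orbit : ∀ x : X, IsMeagre (MulAction.orbit G x)

/-- `r` is a Borel reduction of the orbit equivalence relation of `G` on `X` to `≃_diff` on the
family `S` of spacetimes, which carries the `C^∞` compact-open topology. -/
structure IsBorelReduction (G : Type) {X : Type} [Group G] [TopologicalSpace X] [MulAction G X]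
    {S : Set Spacetime} (r : X → S) : Prop where
  borel : @Measurable X S (borel X) (borel S) r
  reduces : ∀ α β : X, MulAction.orbit G α = MulAction.orbit G β ↔
    DiffEquivalent (r α : Spacetime) (r β : Spacetime)

/-- A family of spacetimes is rich if the orbit equivalence relation of some generically ergodic
Polish `G`-space is Borel reducible to `≃_diff` on it. (A Polish space has at most continuum many
points, so nothing is lost by taking `G` and `X` in `Type`.) -/
def IsRich (S : Set Spacetime) : Prop :=
  ∃ (G X : Type) (_ : Group G) (_ : TopologicalSpace G) (_ : TopologicalSpace X)
    (_ : MulAction G X),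
    IsGenericallyErgodic G X ∧ ∃ r : X → S, IsBorelReduction G r

/-! ### The Bernoulli shift -/

/-- The space `{0,1}^ℤ`, with the product topology. -/
def BernoulliSpace : Type := ℤ → Bool

instance : TopologicalSpace BernoulliSpace := inferInstanceAs (TopologicalSpace (ℤ → Bool))

/-- The shift action of `ℤ` (written multiplicatively): `(k · α)(n) = α(n - k)`. -/
instance : MulAction (Multiplicative ℤ) BernoulliSpace where
  smul k α := fun n => α (n - k.toAdd)
  one_smul α := by
    funext n
    change α (n - 0) = α n
    rw [sub_zero]
  mul_smul k l α := by
    funext n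
    change α (n - (k.toAdd + l.toAdd)) = α (n - k.toAdd - l.toAdd)
    rw [sub_sub]

/-! ### The plane waves -/

/-- The plane wave in Brinkmann form `H du² + du dv + dx² + dy²` with `H(u,x,y) = w(u) x y`,
in the coordinates `(x⁰, x¹, x², x³) = (u, v, x, y)`. -/
def planeWave (w : ℝ → ℝ) (p : R4) : Components :=
  ![![w (p 0) * p 2 * p 3, 1 / 2, 0, 0],
    ![1 / 2, 0, 0, 0],
    ![0, 0, 1, 0],
    ![0, 0, 0, 1]]

/-- A smooth bell curve `[0,1] → [0,1]` which vanishes to infinite order at both end points (that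
is, a smooth function on `ℝ` once it is extended by zero), takes the value `1` at exactly one point,
which lies to the left of `1/2`, and is not symmetric about any vertical axis. -/
structure IsBellCurve (W : ℝ → ℝ) : Prop where
  smooth : ContDiff ℝ ∞ W
  eq_zero : ∀ x, x ∉ Set.Icc (0 : ℝ) 1 → W x = 0
  mem_Icc : ∀ x, W x ∈ Set.Icc (0 : ℝ) 1
  peak : ∃ x₀ < (1 / 2 : ℝ), W x₀ = 1 ∧ ∀ x, W x = 1 → x = x₀
  asymmetric : ∀ c : ℝ, ∃ t : ℝ, W (c + t) ≠ W (c - t)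

/-- The function `W_α`: on `[n, n+1)` it is `2 + W(u - n)` if `α(n) = 1` and `2 - W(u - n)` if
`α(n) = 0`. -/
def pulseTrain (W : ℝ → ℝ) (α : BernoulliSpace) (u : ℝ) : ℝ :=
  if α ⌊u⌋ = true then 2 + W (u - ⌊u⌋) else 2 - W (u - ⌊u⌋)

end

/-!
The orbit of a sequence under the shift is countable, hence meager, and a Baire category argument
over a countable basis produces a dense orbit.

That sequences in one orbit yield isometric waves is clear, since shifting `α` translates `u`. For
the converse, let `φ` be an isometry between plane waves with positive profiles. It pulls the
coordinate functions of the target back to functions `f` on the source whose covariant Hessian is a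
multiple `S du²` of `du²`. The second derivatives of such an `f` are expressed through `S` and the
first derivatives, and their integrability conditions force `∂_v f = 0` and express `∂_x S` and
`∂_y S` through `∂_x f` and `∂_y f`. For `f = φ⁰` one has `S = 0`, so
`φ⁰ = a u + b`. For `f = φ²` and `f = φ³` the derivatives satisfy a linear system, which together
with orthonormality of the spatial part of the Jacobian yields `w₁(u) = a² w₂(a u + b)`.

For the profiles `W_α`, comparing maximum and minimum gives `a² = 1`. The extremal values `1` and
`3` are attained only at the translates of the peak of `W`, which makes `u ↦ a u + b` a translation
by an integer or a reflection of these points. Reflections match only constant sequences, for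
otherwise they would exhibit a symmetry of `W`.
-/

/-! ### Partial derivatives -/

section PartialDeriv

variable {f g : R4 → ℝ} {x : R4} {μ ν : Fin 4}

theorem partialDeriv_const (c : ℝ) : partialDeriv μ (fun _ => c) x = 0 := by
  simp [partialDeriv]

theorem partialDeriv_add (hf : DifferentiableAt ℝ f x) (hg : DifferentiableAt ℝ g x) :
    partialDeriv μ (fun y => f y + g y) x = partialDeriv μ f x + partialDeriv μ g x := by
  simp [partialDeriv, fderiv_fun_add hf hg]

theorem partialDeriv_mul (hf : DifferentiableAt ℝ f x) (hg : DifferentiableAt ℝ g x) :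
    partialDeriv μ (fun y => f y * g y) x =
      partialDeriv μ f x * g x + f x * partialDeriv μ g x := by
  simp only [partialDeriv, fderiv_fun_mul hf hg, add_apply, smul_apply, smul_eq_mul]
  ring

theorem partialDeriv_const_mul (c : ℝ) (hf : DifferentiableAt ℝ f x) :
    partialDeriv μ (fun y => c * f y) x = c * partialDeriv μ f x := by
  simp [partialDeriv, fderiv_const_mul hf]

theorem partialDeriv_sum {ι : Type*} {s : Finset ι} {F : ι → R4 → ℝ}
    (hF : ∀ i ∈ s, DifferentiableAt ℝ (F i) x) :
    partialDeriv μ (fun y => ∑ i ∈ s, F i y) x = ∑ i ∈ s, partialDeriv μ (F i) x := by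
  simp [partialDeriv, fderiv_fun_sum hF]

theorem partialDeriv_coord : partialDeriv μ (fun y => y ν) x = if ν = μ then 1 else 0 := by
  simp [partialDeriv, (hasFDerivAt_apply (𝕜 := ℝ) ν x).fderiv, Pi.single_apply]

theorem fderiv_apply_eq_sum_partialDeriv (v : R4) :
    fderiv ℝ f x v = ∑ μ, v μ * partialDeriv μ f x := by
  conv_lhs => rw [pi_eq_sum_univ' v]
  simp only [map_sum, map_smul, smul_eq_mul, partialDeriv]

theorem partialDeriv_comp {w : ℝ → ℝ} (hw : DifferentiableAt ℝ w (f x))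
    (hf : DifferentiableAt ℝ f x) :
    partialDeriv μ (fun y => w (f y)) x = deriv w (f x) * partialDeriv μ f x :=
  DFunLike.congr_fun (hw.hasDerivAt.comp_hasFDerivAt x hf.hasFDerivAt).fderiv (Pi.single μ 1)

theorem partialDeriv_comp_eq_sum {φ : R4 → R4} (hf : DifferentiableAt ℝ f (φ x))
    (hφ : DifferentiableAt ℝ φ x) :
    partialDeriv μ (fun y => f (φ y)) x =
      ∑ ρ, partialDeriv μ (fun y => φ y ρ) x * partialDeriv ρ f (φ x) := by
  have hcomp : partialDeriv μ (fun y => f (φ y)) x =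
      fderiv ℝ f (φ x) (fderiv ℝ φ x (Pi.single μ 1)) :=
    DFunLike.congr_fun (fderiv_comp x hf hφ) (Pi.single μ 1)
  rw [hcomp, fderiv_apply_eq_sum_partialDeriv]
  simp only [partialDeriv, fderiv_apply hφ, ContinuousLinearMap.comp_apply,
    ContinuousLinearMap.proj_apply]

@[fun_prop]
theorem contDiff_partialDeriv (hf : ContDiff ℝ ∞ f) : ContDiff ℝ ∞ (partialDeriv μ f) :=
  (hf.fderiv_right (m := ∞) (by norm_num)).clm_apply contDiff_const

@[fun_prop]
theorem differentiable_partialDeriv (hf : ContDiff ℝ ∞ f) : Differentiable ℝ (partialDeriv μ f) :=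
  (contDiff_partialDeriv hf).differentiable (by norm_num)

theorem partialDeriv_partialDeriv (hf : ContDiff ℝ ∞ f) :
    partialDeriv μ (partialDeriv ν f) x =
      fderiv ℝ (fderiv ℝ f) x (Pi.single μ 1) (Pi.single ν 1) := by
  have hdf : Differentiable ℝ (fderiv ℝ f) :=
    (hf.fderiv_right (m := ∞) (by norm_num)).differentiable (by norm_num)
  change fderiv ℝ (fun y => fderiv ℝ f y (Pi.single ν 1)) x _ = _
  rw [fderiv_clm_apply hdf.differentiableAt (differentiableAt_const _)]
  simp

theorem partialDeriv_comm (hf : ContDiff ℝ ∞ f) (μ ν : Fin 4) (x : R4) :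
    partialDeriv μ (partialDeriv ν f) x = partialDeriv ν (partialDeriv μ f) x := by
  rw [partialDeriv_partialDeriv hf, partialDeriv_partialDeriv hf]
  exact (hf.contDiffAt.isSymmSndFDerivAt (by simpa using ENat.LEInfty.out)).eq _ _

theorem eq_of_partialDeriv_eq_zero (hf : Differentiable ℝ f)
    (h : ∀ μ x, partialDeriv μ f x = 0) (x y : R4) : f x = f y := by
  refine is_const_of_fderiv_eq_zero hf (fun z => ?_) x y
  ext v
  simp [fderiv_apply_eq_sum_partialDeriv, h]

theorem eq_affine_of_partialDeriv_partialDeriv_eq_zero (hf : ContDiff ℝ ∞ f)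
    (h : ∀ μ ν x, partialDeriv μ (partialDeriv ν f) x = 0) (x : R4) :
    f x = f 0 + ∑ μ, partialDeriv μ f 0 * x μ := by
  have hdf : Differentiable ℝ f := hf.differentiable (by norm_num)
  have hconst : ∀ ν y, partialDeriv ν f y = partialDeriv ν f 0 := fun ν y =>
    eq_of_partialDeriv_eq_zero (differentiable_partialDeriv hf) (h · ν) y 0
  have hlin : Differentiable ℝ fun y => f y + -1 * ∑ ν, partialDeriv ν f 0 * y ν := by fun_prop
  have hdiff := eq_of_partialDeriv_eq_zero hlin (fun μ y => ?_) x 0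
  · simp only [Pi.zero_apply, mul_zero, Finset.sum_const_zero, add_zero] at hdiff
    linarith
  · rw [partialDeriv_add hdf.differentiableAt (by fun_prop),
      partialDeriv_const_mul _ (by fun_prop), partialDeriv_sum fun _ _ => by fun_prop]
    simp [partialDeriv_const_mul _ (differentiableAt_apply _ _), partialDeriv_coord, hconst]

end PartialDeriv

/-! ### Christoffel symbols and pullbacks -/

namespace Spacetime

variable (g : Spacetime)

theorem contDiff_metric (μ ν : Fin 4) : ContDiff ℝ ∞ fun y => g.metric y μ ν :=
  contDiff_pi.1 (contDiff_pi.1 g.smooth μ) ν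

@[fun_prop]
theorem differentiable_metric (μ ν : Fin 4) : Differentiable ℝ fun y => g.metric y μ ν :=
  (g.contDiff_metric μ ν).differentiable (by norm_num)

theorem isUnit_det_metric (x : R4) : IsUnit (Matrix.of (g.metric x)).det := by
  obtain ⟨-, P, -, hP⟩ := g.lorentzian x
  have hdet := congrArg Matrix.det hP
  rw [Matrix.det_mul, Matrix.det_mul, Matrix.det_diagonal] at hdet
  rw [isUnit_iff_ne_zero]
  intro hzero
  simp [hzero, Fin.prod_univ_succ] at hdet

/-- The Christoffel symbols of the first kind `Γ_{κμν}`, i.e. `Γ^l_{μν}` with `l` lowered to the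
index `κ`. -/
noncomputable def christoffelFirst (κ μ ν : Fin 4) (x : R4) : ℝ :=
  (1 / 2) * (partialDeriv μ (fun y => g.metric y ν κ) x +
    partialDeriv ν (fun y => g.metric y μ κ) x - partialDeriv κ (fun y => g.metric y μ ν) x)

theorem sum_metric_mul_christoffel (κ μ ν : Fin 4) (x : R4) :
    ∑ l, g.metric x κ l * g.christoffel l μ ν x = g.christoffelFirst κ μ ν x := by
  let T : Fin 4 → ℝ := fun s => g.christoffelFirst s μ ν x
  have hΓ : (fun l => g.christoffel l μ ν x) = (Matrix.of (g.metric x))⁻¹.mulVec T := by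
    funext l
    simp only [christoffel, inverse, Finset.mul_sum, Matrix.mulVec, dotProduct, T,
      christoffelFirst]
    exact Finset.sum_congr rfl fun s _ => by ring
  change (Matrix.of (g.metric x)).mulVec (fun l => g.christoffel l μ ν x) κ = T κ
  rw [hΓ, Matrix.mulVec_mulVec, Matrix.mul_nonsing_inv _ (g.isUnit_det_metric x),
    Matrix.one_mulVec]

/-- The components `∂_μ ∂_ν f - Γ^l_{μν} ∂_l f` of the covariant Hessian `∇∇f`. -/
noncomputable def hessian (f : R4 → ℝ) (μ ν : Fin 4) (x : R4) : ℝ :=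
  partialDeriv μ (partialDeriv ν f) x - ∑ l, g.christoffel l μ ν x * partialDeriv l f x

end Spacetime

/-- The matrix of the derivative of `φ` at `x`, with rows indexed by the source: its entry at
`(μ, ρ)` is `∂φ^ρ/∂x^μ`. -/
noncomputable def jacobian (φ : R4 → R4) (x : R4) : Matrix (Fin 4) (Fin 4) ℝ :=
  Matrix.of fun μ ρ => partialDeriv μ (fun y => φ y ρ) x

/-- `g = φ^* g'`, for a map `φ` of `ℝ⁴` that need not be a diffeomorphism. -/
def IsPullback (φ : R4 → R4) (g' g : Spacetime) : Prop :=
  ∀ (x : R4) (μ ν : Fin 4), g.metric x μ ν = ∑ ρ, ∑ σ,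
    partialDeriv μ (fun y => φ y ρ) x * partialDeriv ν (fun y => φ y σ) x * g'.metric (φ x) ρ σ

namespace IsPullback

variable {φ : R4 → R4} {g' g : Spacetime}

theorem metric_eq (h : IsPullback φ g' g) (x : R4) :
    Matrix.of (g.metric x) =
      jacobian φ x * Matrix.of (g'.metric (φ x)) * (jacobian φ x).transpose := by
  ext μ ν
  simp only [Matrix.of_apply, h x μ ν, Matrix.mul_apply, Matrix.transpose_apply, jacobian,
    Finset.sum_mul]
  rw [Finset.sum_comm]
  exact Finset.sum_congr rfl fun σ _ => Finset.sum_congr rfl fun ρ _ => by ring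

theorem isUnit_det_jacobian (h : IsPullback φ g' g) (x : R4) : IsUnit (jacobian φ x).det := by
  have hdet := g.isUnit_det_metric x
  rw [h.metric_eq, Matrix.det_mul, Matrix.det_transpose] at hdet
  exact isUnit_of_mul_isUnit_right hdet

theorem partialDeriv_metric (h : IsPullback φ g' g) (hφ : ∀ ρ, ContDiff ℝ ∞ fun y => φ y ρ)
    (κ μ ν : Fin 4) (x : R4) :
    partialDeriv κ (fun y => g.metric y μ ν) x = ∑ ρ, ∑ σ,
      ((partialDeriv κ (partialDeriv μ fun y => φ y ρ) x * partialDeriv ν (fun y => φ y σ) x +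
          partialDeriv μ (fun y => φ y ρ) x * partialDeriv κ (partialDeriv ν fun y => φ y σ) x) *
          g'.metric (φ x) ρ σ +
        partialDeriv μ (fun y => φ y ρ) x * partialDeriv ν (fun y => φ y σ) x *
          ∑ τ, partialDeriv κ (fun y => φ y τ) x *
            partialDeriv τ (fun y => g'.metric y ρ σ) (φ x)) := by
  have hφ' : Differentiable ℝ φ := (contDiff_pi.2 hφ).differentiable (by norm_num)
  have : ∀ μ ρ, Differentiable ℝ (partialDeriv μ fun y => φ y ρ) :=
    fun μ ρ => differentiable_partialDeriv (hφ ρ)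
  have : ∀ ρ σ, Differentiable ℝ fun y => g'.metric (φ y) ρ σ :=
    fun ρ σ => (g'.differentiable_metric ρ σ).comp hφ'
  simp only [funext fun y => h y μ ν]
  rw [partialDeriv_sum fun _ _ => by fun_prop]
  refine Finset.sum_congr rfl fun ρ _ => ?_
  rw [partialDeriv_sum fun _ _ => by fun_prop]
  refine Finset.sum_congr rfl fun σ _ => ?_
  rw [partialDeriv_mul (by fun_prop) (by fun_prop), partialDeriv_mul (by fun_prop) (by fun_prop),
    partialDeriv_comp_eq_sum (f := fun y => g'.metric y ρ σ) (by fun_prop) (by fun_prop)]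

theorem christoffelFirst_eq (h : IsPullback φ g' g) (hφ : ∀ ρ, ContDiff ℝ ∞ fun y => φ y ρ)
    (κ μ ν : Fin 4) (x : R4) :
    g.christoffelFirst κ μ ν x = ∑ σ, partialDeriv κ (fun y => φ y σ) x *
      (∑ ρ, g'.metric (φ x) σ ρ * partialDeriv μ (partialDeriv ν fun y => φ y ρ) x +
        ∑ ρ, ∑ τ, g'.christoffelFirst σ ρ τ (φ x) *
          (partialDeriv μ (fun y => φ y ρ) x * partialDeriv ν (fun y => φ y τ) x)) := by
  simp only [Spacetime.christoffelFirst, h.partialDeriv_metric hφ]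
  have hsymm := (g'.lorentzian (φ x)).1
  have hcomm := fun ρ => partialDeriv_comm (hφ ρ)
  simp only [hcomm _ κ, hcomm _ ν μ]
  simp only [Fin.sum_univ_four, hsymm 1 0, hsymm 2 0, hsymm 3 0, hsymm 2 1, hsymm 3 1, hsymm 3 2]
  ring

theorem hessian_apply (h : IsPullback φ g' g) (hφ : ∀ ρ, ContDiff ℝ ∞ fun y => φ y ρ)
    (l μ ν : Fin 4) (x : R4) :
    g.hessian (fun y => φ y l) μ ν x = -∑ ρ, ∑ τ, g'.christoffel l ρ τ (φ x) *
      (partialDeriv μ (fun y => φ y ρ) x * partialDeriv ν (fun y => φ y τ) x) := by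
  let v : Fin 4 → ℝ := fun l => g.hessian (fun y => φ y l) μ ν x +
    ∑ ρ, ∑ τ, g'.christoffel l ρ τ (φ x) *
      (partialDeriv μ (fun y => φ y ρ) x * partialDeriv ν (fun y => φ y τ) x)
  suffices hv : v = 0 from eq_neg_of_add_eq_zero_left (congrFun hv l)
  refine Matrix.eq_zero_of_mulVec_eq_zero (g'.isUnit_det_metric (φ x)).ne_zero <|
    Matrix.eq_zero_of_mulVec_eq_zero (h.isUnit_det_jacobian x).ne_zero (funext fun κ => ?_)
  have hΓ := (g.sum_metric_mul_christoffel κ μ ν x).trans (h.christoffelFirst_eq hφ κ μ ν x)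
  simp only [h x κ, ← g'.sum_metric_mul_christoffel] at hΓ
  simp only [Matrix.mulVec, dotProduct, v, jacobian, Matrix.of_apply, Spacetime.hessian,
    Pi.zero_apply]
  simp only [Fin.sum_univ_four] at hΓ ⊢
  linear_combination -hΓ

end IsPullback

theorem diffEquivalent_iff_exists_isPullback {g' g : Spacetime} :
    DiffEquivalent g' g ↔
      ∃ φ : Diffeomorph 𝓘(ℝ, R4) 𝓘(ℝ, R4) R4 R4 ∞, IsPullback φ g' g :=
  Iff.rfl

/-! ### pp-waves -/

section PPWave

variable {H : R4 → ℝ}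

/-- The pp-wave `H du² + du dv + dx² + dy²` in Brinkmann form, with an arbitrary profile `H`. -/
noncomputable def ppWave (H : R4 → ℝ) (p : R4) : Components :=
  ![![H p, 1 / 2, 0, 0],
    ![1 / 2, 0, 0, 0],
    ![0, 0, 1, 0],
    ![0, 0, 0, 1]]

theorem contDiff_ppWave (hH : ContDiff ℝ ∞ H) : ContDiff ℝ ∞ (ppWave H) := by
  refine contDiff_pi' fun μ => contDiff_pi' fun ν => ?_
  simp only [ppWave]
  fin_cases μ <;> fin_cases ν <;> first | exact contDiff_const | exact hH

theorem isLorentzian_ppWave (p : R4) : IsLorentzian (ppWave H p) := by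
  -- The first two basis vectors are `∂_u - (1 + H) ∂_v` and `∂_u + (1 - H) ∂_v`, since
  -- `∂_u + c ∂_v` has square `H + c`.
  refine ⟨fun μ ν => by fin_cases μ <;> fin_cases ν <;> rfl,
    !![1, 1, 0, 0; -1 - H p, 1 - H p, 0, 0; 0, 0, 1, 0; 0, 0, 0, 1], ?_, ?_⟩
  · rw [isUnit_iff_ne_zero]
    simp [Matrix.det_succ_row_zero, Fin.sum_univ_succ, Fin.succAbove]
    ring_nf
    norm_num
  · ext i j
    fin_cases i <;> fin_cases j <;>
      simp [ppWave, Matrix.mul_apply, Fin.sum_univ_succ, Matrix.transpose_apply] <;> ring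

/-- The pp-wave with profile `H`, as a spacetime. -/
noncomputable def ppWaveSpacetime (H : R4 → ℝ) (hH : ContDiff ℝ ∞ H) : Spacetime where
  metric := ppWave H
  smooth := contDiff_ppWave hH
  lorentzian := isLorentzian_ppWave

theorem inverse_ppWaveSpacetime (hH : ContDiff ℝ ∞ H) (x : R4) (μ ν : Fin 4) :
    (ppWaveSpacetime H hH).inverse x μ ν =
      !![0, 2, 0, 0; 2, -4 * H x, 0, 0; 0, 0, 1, 0; 0, 0, 0, 1] μ ν := by
  unfold Spacetime.inverse
  rw [Matrix.inv_eq_right_inv]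
  ext i j
  fin_cases i <;> fin_cases j <;>
    simp [ppWaveSpacetime, ppWave, Matrix.mul_apply, Fin.sum_univ_succ]
  ring

theorem partialDeriv_ppWave (κ μ ν : Fin 4) (x : R4) :
    partialDeriv κ (fun y => ppWave H y μ ν) x =
      if μ = 0 ∧ ν = 0 then partialDeriv κ H x else 0 := by
  simp only [ppWave]
  fin_cases μ <;> fin_cases ν <;> simp [partialDeriv_const]

theorem christoffel_ppWaveSpacetime (hH : ContDiff ℝ ∞ H) (hv : ∀ x, partialDeriv 1 H x = 0)
    (l μ ν : Fin 4) (x : R4) :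
    (ppWaveSpacetime H hH).christoffel l μ ν x =
      ![0,
        if μ = 0 then partialDeriv ν H x else if ν = 0 then partialDeriv μ H x else 0,
        if μ = 0 ∧ ν = 0 then -(1 / 2) * partialDeriv 2 H x else 0,
        if μ = 0 ∧ ν = 0 then -(1 / 2) * partialDeriv 3 H x else 0] l := by
  have hmetric : (ppWaveSpacetime H hH).metric = ppWave H := rfl
  simp only [Spacetime.christoffel, inverse_ppWaveSpacetime, hmetric, partialDeriv_ppWave]
  fin_cases l <;> fin_cases μ <;> fin_cases ν <;> simp [Fin.sum_univ_succ, hv]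

theorem christoffel_trace_ppWaveSpacetime (hH : ContDiff ℝ ∞ H)
    (hv : ∀ x, partialDeriv 1 H x = 0) (l μ : Fin 4) (x : R4) :
    (ppWaveSpacetime H hH).christoffel l l μ x = 0 := by
  rw [christoffel_ppWaveSpacetime hH hv]
  fin_cases l <;> fin_cases μ <;> simp [hv]

theorem sum_partialDeriv_christoffel_ppWaveSpacetime (hH : ContDiff ℝ ∞ H)
    (hv : ∀ x, partialDeriv 1 H x = 0) (μ ν : Fin 4) (x : R4) :
    ∑ l, partialDeriv l ((ppWaveSpacetime H hH).christoffel l μ ν) x =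
      if μ = 0 ∧ ν = 0 then -(1 / 2) * (partialDeriv 2 (partialDeriv 2 H) x +
        partialDeriv 3 (partialDeriv 3 H) x) else 0 := by
  have hv' : ∀ κ, partialDeriv 1 (partialDeriv κ H) x = 0 := fun κ => by
    rw [partialDeriv_comm hH, funext hv, partialDeriv_const]
  have hD : ∀ κ, DifferentiableAt ℝ (partialDeriv κ H) x := fun κ => by fun_prop
  simp only [funext (christoffel_ppWaveSpacetime hH hv _ μ ν), Fin.sum_univ_four, Matrix.cons_val]
  have hv1 : partialDeriv 1 (fun y => if μ = 0 then partialDeriv ν H y else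
      if ν = 0 then partialDeriv μ H y else 0) x = 0 := by
    split_ifs <;> simp only [hv', partialDeriv_const]
  rw [hv1]
  split_ifs
  · rw [partialDeriv_const, partialDeriv_const_mul _ (hD 2), partialDeriv_const_mul _ (hD 3)]
    ring
  · simp only [partialDeriv_const, add_zero]

theorem ricci_ppWaveSpacetime (hH : ContDiff ℝ ∞ H) (hv : ∀ x, partialDeriv 1 H x = 0)
    (μ ν : Fin 4) (x : R4) :
    (ppWaveSpacetime H hH).ricci μ ν x =
      if μ = 0 ∧ ν = 0 then -(1 / 2) * (partialDeriv 2 (partialDeriv 2 H) x +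
        partialDeriv 3 (partialDeriv 3 H) x) else 0 := by
  have hquadratic : ∀ l s, (ppWaveSpacetime H hH).christoffel l ν s x *
      (ppWaveSpacetime H hH).christoffel s l μ x = 0 := fun l s => by
    simp only [christoffel_ppWaveSpacetime hH hv]
    fin_cases l <;> fin_cases s <;> simp [hv]
  simp only [Spacetime.ricci, funext (christoffel_trace_ppWaveSpacetime hH hv _ _),
    partialDeriv_const, hquadratic, zero_mul, sub_zero, Finset.sum_const_zero, add_zero,
    sum_partialDeriv_christoffel_ppWaveSpacetime hH hv]

theorem ppWaveSpacetime_mem_vacuumSolutions (hH : ContDiff ℝ ∞ H)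
    (hv : ∀ x, partialDeriv 1 H x = 0)
    (hΔ : ∀ x, partialDeriv 2 (partialDeriv 2 H) x + partialDeriv 3 (partialDeriv 3 H) x = 0) :
    ppWaveSpacetime H hH ∈ vacuumSolutions := by
  intro x μ ν
  simp [Spacetime.einstein, Spacetime.scalarCurvature, ricci_ppWaveSpacetime hH hv, hΔ]

end PPWave

/-! ### Functions whose Hessian is a multiple of `du²` -/

/-- The equation `∇∇F = S du²`. The components of an isometry between two plane waves satisfy
equations of this form. -/
def HessianEqDuSq (g : Spacetime) (F S : R4 → ℝ) : Prop :=
  ∀ μ ν x, g.hessian F μ ν x = if μ = 0 ∧ ν = 0 then S x else 0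

namespace HessianEqDuSq

variable {H F S : R4 → ℝ} {hH : ContDiff ℝ ∞ H} {x : R4} {i j : Fin 4}

theorem partialDeriv_partialDeriv (h : HessianEqDuSq (ppWaveSpacetime H hH) F S)
    (hv : ∀ x, partialDeriv 1 H x = 0) (hi : i ≠ 0) (hj : j ≠ 0) (x : R4) :
    partialDeriv i (partialDeriv j F) x = 0 := by
  simpa [Spacetime.hessian, christoffel_ppWaveSpacetime hH hv, Fin.sum_univ_four, hi, hj]
    using h i j x

theorem partialDeriv_zero_partialDeriv (h : HessianEqDuSq (ppWaveSpacetime H hH) F S)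
    (hv : ∀ x, partialDeriv 1 H x = 0) (hi : i ≠ 0) (x : R4) :
    partialDeriv 0 (partialDeriv i F) x = partialDeriv i H x * partialDeriv 1 F x := by
  simpa [Spacetime.hessian, christoffel_ppWaveSpacetime hH hv, Fin.sum_univ_four, hi, sub_eq_zero]
    using h 0 i x

theorem partialDeriv_zero_partialDeriv_zero (h : HessianEqDuSq (ppWaveSpacetime H hH) F S)
    (hv : ∀ x, partialDeriv 1 H x = 0) (hF1 : ∀ x, partialDeriv 1 F x = 0) (x : R4) :
    partialDeriv 0 (partialDeriv 0 F) x = S x + -(1 / 2) *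
      (partialDeriv 2 H x * partialDeriv 2 F x + partialDeriv 3 H x * partialDeriv 3 F x) := by
  have h00 := h 0 0 x
  simp only [Spacetime.hessian, christoffel_ppWaveSpacetime hH hv, Fin.sum_univ_four, hF1,
    Matrix.cons_val, and_self, if_true] at h00
  linear_combination h00

/-- Integrability: `∂_i ∂_0 ∂_j F = ∂_0 ∂_i ∂_j F`. -/
theorem partialDeriv_partialDeriv_mul_partialDeriv_one
    (h : HessianEqDuSq (ppWaveSpacetime H hH) F S) (hF : ContDiff ℝ ∞ F)
    (hv : ∀ x, partialDeriv 1 H x = 0) (hi : i ≠ 0) (hj : j ≠ 0) (x : R4) :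
    partialDeriv i (partialDeriv j H) x * partialDeriv 1 F x = 0 := by
  have hcomm := partialDeriv_comm (contDiff_partialDeriv (μ := j) hF) i 0 x
  rw [funext (h.partialDeriv_zero_partialDeriv hv hj),
    funext (h.partialDeriv_partialDeriv hv hi hj), partialDeriv_const,
    partialDeriv_mul (by fun_prop) (by fun_prop),
    h.partialDeriv_partialDeriv hv hi one_ne_zero, mul_zero, add_zero] at hcomm
  exact hcomm

theorem partialDeriv_source (h : HessianEqDuSq (ppWaveSpacetime H hH) F S)
    (hF : ContDiff ℝ ∞ F) (hS : Differentiable ℝ S) (hv : ∀ x, partialDeriv 1 H x = 0)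
    (hF1 : ∀ x, partialDeriv 1 F x = 0) (hi : i ≠ 0) (x : R4) :
    partialDeriv i S x = (1 / 2) * (partialDeriv i (partialDeriv 2 H) x * partialDeriv 2 F x +
      partialDeriv i (partialDeriv 3 H) x * partialDeriv 3 F x) := by
  have hcomm := partialDeriv_comm (contDiff_partialDeriv (μ := 0) hF) i 0 x
  have h0i : partialDeriv i (partialDeriv 0 F) = fun _ => 0 := funext fun y => by
    rw [partialDeriv_comm hF, h.partialDeriv_zero_partialDeriv hv hi, hF1, mul_zero]
  rw [h0i, partialDeriv_const, funext (h.partialDeriv_zero_partialDeriv_zero hv hF1),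
    partialDeriv_add (by fun_prop) (by fun_prop), partialDeriv_const_mul _ (by fun_prop),
    partialDeriv_add (by fun_prop) (by fun_prop), partialDeriv_mul (by fun_prop) (by fun_prop),
    partialDeriv_mul (by fun_prop) (by fun_prop),
    h.partialDeriv_partialDeriv hv hi (by decide),
    h.partialDeriv_partialDeriv hv hi (by decide)] at hcomm
  linarith

end HessianEqDuSq

theorem partialDeriv_mul_coord_add (a b : ℝ) (μ ρ : Fin 4) (x : R4) :
    partialDeriv μ (fun y => a * y ρ + b) x = if ρ = μ then a else 0 := by
  rw [partialDeriv_add (by fun_prop) (by fun_prop), partialDeriv_const_mul _ (by fun_prop),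
    partialDeriv_coord, partialDeriv_const, add_zero, mul_ite, mul_one, mul_zero]

namespace IsPullback

variable {H : R4 → ℝ} {hH : ContDiff ℝ ∞ H} {φ : R4 → R4} {g : Spacetime} {a b : ℝ}

theorem hessianEqDuSq_apply_zero (h : IsPullback φ (ppWaveSpacetime H hH) g)
    (hφ : ∀ ρ, ContDiff ℝ ∞ fun y => φ y ρ) (hv : ∀ x, partialDeriv 1 H x = 0) :
    HessianEqDuSq g (fun y => φ y 0) fun _ => 0 := by
  intro μ ν x
  simp [h.hessian_apply hφ, christoffel_ppWaveSpacetime hH hv]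

theorem hessianEqDuSq_apply (h : IsPullback φ (ppWaveSpacetime H hH) g)
    (hφ : ∀ ρ, ContDiff ℝ ∞ fun y => φ y ρ) (hv : ∀ x, partialDeriv 1 H x = 0)
    (hφ0 : ∀ x, φ x 0 = a * x 0 + b) {i : Fin 4} (hi : i = 2 ∨ i = 3) :
    HessianEqDuSq g (fun y => φ y i) fun y => (1 / 2) * (a ^ 2 * partialDeriv i H (φ y)) := by
  intro μ ν x
  rw [h.hessian_apply hφ]
  have hdφ0 : ∀ κ, partialDeriv κ (fun y => φ y 0) x = if κ = 0 then a else 0 := fun κ => by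
    simp only [hφ0, partialDeriv_mul_coord_add, eq_comm]
  have hΓ : ∀ ρ τ, (ppWaveSpacetime H hH).christoffel i ρ τ (φ x) =
      if ρ = 0 ∧ τ = 0 then -(1 / 2) * partialDeriv i H (φ x) else 0 := fun ρ τ => by
    rw [christoffel_ppWaveSpacetime hH hv]
    rcases hi with rfl | rfl <;> rfl
  simp only [hΓ, ite_and, ite_mul, zero_mul, Finset.sum_ite_irrel, Finset.sum_ite_eq',
    Finset.sum_const_zero, Finset.mem_univ, if_true, hdφ0]
  split_ifs <;> ring

theorem sq_add_sq_eq_metric (h : IsPullback φ (ppWaveSpacetime H hH) g)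
    (hφ0 : ∀ x, φ x 0 = a * x 0 + b) {i : Fin 4} (hi : i ≠ 0) (x : R4) :
    partialDeriv i (fun y => φ y 2) x ^ 2 + partialDeriv i (fun y => φ y 3) x ^ 2 =
      g.metric x i i := by
  have hdφ0 : partialDeriv i (fun y => φ y 0) x = 0 := by
    simp only [hφ0, partialDeriv_mul_coord_add, if_neg hi.symm]
  rw [h x i i]
  simp [Fin.sum_univ_four, ppWaveSpacetime, ppWave, hdφ0]
  ring

end IsPullback

/-! ### Rigidity of plane waves -/

section PlaneWave

variable {w w₁ w₂ : ℝ → ℝ} {F S : R4 → ℝ}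

/-- The profile `w(u) x y` of a plane wave. -/
noncomputable def brinkmannProfile (w : ℝ → ℝ) (p : R4) : ℝ := w (p 0) * p 2 * p 3

theorem contDiff_brinkmannProfile (hw : ContDiff ℝ ∞ w) : ContDiff ℝ ∞ (brinkmannProfile w) := by
  unfold brinkmannProfile
  fun_prop

theorem partialDeriv_brinkmannProfile (hw : Differentiable ℝ w) (μ : Fin 4) (x : R4) :
    partialDeriv μ (brinkmannProfile w) x =
      ![deriv w (x 0) * x 2 * x 3, 0, w (x 0) * x 3, w (x 0) * x 2] μ := by
  unfold brinkmannProfile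
  rw [partialDeriv_mul (by fun_prop) (by fun_prop), partialDeriv_mul (by fun_prop) (by fun_prop),
    partialDeriv_comp (hw _) (by fun_prop)]
  simp only [partialDeriv_coord]
  fin_cases μ <;> simp

theorem partialDeriv_brinkmannProfile_two (hw : Differentiable ℝ w) {i : Fin 4} (hi : i ≠ 0)
    (x : R4) :
    partialDeriv i (partialDeriv 2 (brinkmannProfile w)) x = if i = 3 then w (x 0) else 0 := by
  rw [funext (partialDeriv_brinkmannProfile hw 2)]
  simp only [Matrix.cons_val]
  rw [partialDeriv_mul (by fun_prop) (by fun_prop), partialDeriv_comp (hw _) (by fun_prop)]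
  simp [partialDeriv_coord, hi.symm, eq_comm]

theorem partialDeriv_brinkmannProfile_three (hw : Differentiable ℝ w) {i : Fin 4} (hi : i ≠ 0)
    (x : R4) :
    partialDeriv i (partialDeriv 3 (brinkmannProfile w)) x = if i = 2 then w (x 0) else 0 := by
  rw [funext (partialDeriv_brinkmannProfile hw 3)]
  simp only [Matrix.cons_val]
  rw [partialDeriv_mul (by fun_prop) (by fun_prop), partialDeriv_comp (hw _) (by fun_prop)]
  simp [partialDeriv_coord, hi.symm, eq_comm]

/-- The plane wave with profile `w(u) x y`, as a spacetime. -/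
noncomputable def planeWaveSpacetime (w : ℝ → ℝ) (hw : ContDiff ℝ ∞ w) : Spacetime :=
  ppWaveSpacetime (brinkmannProfile w) (contDiff_brinkmannProfile hw)

theorem planeWaveSpacetime_mem_vacuumSolutions (hw : ContDiff ℝ ∞ w) :
    planeWaveSpacetime w hw ∈ vacuumSolutions := by
  have hdw : Differentiable ℝ w := hw.differentiable (by norm_num)
  refine ppWaveSpacetime_mem_vacuumSolutions _ (fun x => ?_) (fun x => ?_)
  · rw [partialDeriv_brinkmannProfile hdw]; rfl
  · rw [partialDeriv_brinkmannProfile_two hdw (by decide),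
      partialDeriv_brinkmannProfile_three hdw (by decide)]
    simp

namespace HessianEqDuSq

variable {hw : ContDiff ℝ ∞ w} (h : HessianEqDuSq (planeWaveSpacetime w hw) F S)
include h

theorem partialDeriv_one_eq_zero (hF : ContDiff ℝ ∞ F) (hw0 : ∀ u, w u ≠ 0) (x : R4) :
    partialDeriv 1 F x = 0 := by
  have hdw : Differentiable ℝ w := hw.differentiable (by norm_num)
  have hint := h.partialDeriv_partialDeriv_mul_partialDeriv_one hF
    (partialDeriv_brinkmannProfile hdw 1) (i := 3) (j := 2) (by decide) (by decide) x
  rw [partialDeriv_brinkmannProfile_two hdw (by decide), if_pos rfl] at hint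
  exact (mul_eq_zero.1 hint).resolve_left (hw0 _)

theorem partialDeriv_two_source (hF : ContDiff ℝ ∞ F) (hS : Differentiable ℝ S)
    (hw0 : ∀ u, w u ≠ 0) (x : R4) :
    partialDeriv 2 S x = (1 / 2) * (w (x 0) * partialDeriv 3 F x) := by
  have hdw : Differentiable ℝ w := hw.differentiable (by norm_num)
  rw [h.partialDeriv_source hF hS (partialDeriv_brinkmannProfile hdw 1)
    (h.partialDeriv_one_eq_zero hF hw0) (by decide),
    partialDeriv_brinkmannProfile_two hdw (by decide),
    partialDeriv_brinkmannProfile_three hdw (by decide)]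
  simp

theorem partialDeriv_three_source (hF : ContDiff ℝ ∞ F) (hS : Differentiable ℝ S)
    (hw0 : ∀ u, w u ≠ 0) (x : R4) :
    partialDeriv 3 S x = (1 / 2) * (w (x 0) * partialDeriv 2 F x) := by
  have hdw : Differentiable ℝ w := hw.differentiable (by norm_num)
  rw [h.partialDeriv_source hF hS (partialDeriv_brinkmannProfile hdw 1)
    (h.partialDeriv_one_eq_zero hF hw0) (by decide),
    partialDeriv_brinkmannProfile_two hdw (by decide),
    partialDeriv_brinkmannProfile_three hdw (by decide)]
  simp

end HessianEqDuSq

theorem exists_affine_of_hessianEqDuSq_zero {hw : ContDiff ℝ ∞ w}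
    (h : HessianEqDuSq (planeWaveSpacetime w hw) F fun _ => 0) (hF : ContDiff ℝ ∞ F)
    (hw0 : ∀ u, w u ≠ 0) : ∃ a b : ℝ, ∀ x, F x = a * x 0 + b := by
  have hv := partialDeriv_brinkmannProfile (hw.differentiable (by norm_num)) 1
  have hF1 := h.partialDeriv_one_eq_zero hF hw0
  have hF3 : ∀ x, partialDeriv 3 F x = 0 := fun x => by
    simpa [partialDeriv_const, hw0] using (h.partialDeriv_two_source hF (by fun_prop) hw0 x).symm
  have hF2 : ∀ x, partialDeriv 2 F x = 0 := fun x => by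
    simpa [partialDeriv_const, hw0] using (h.partialDeriv_three_source hF (by fun_prop) hw0 x).symm
  have hF0 : ∀ x, partialDeriv 0 (partialDeriv 0 F) x = 0 := fun x => by
    rw [h.partialDeriv_zero_partialDeriv_zero hv hF1, hF2, hF3]
    ring
  have hspatial : ∀ j ≠ 0, partialDeriv j F = fun _ => 0 := fun j hj => funext fun x => by
    fin_cases j
    exacts [absurd rfl hj, hF1 x, hF2 x, hF3 x]
  have hsecond : ∀ μ ν x, partialDeriv μ (partialDeriv ν F) x = 0 := fun μ ν x => by
    rcases eq_or_ne ν 0 with rfl | hν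
    · rcases eq_or_ne μ 0 with rfl | hμ
      · exact hF0 x
      · rw [partialDeriv_comm hF, hspatial μ hμ, partialDeriv_const]
    · rw [hspatial ν hν, partialDeriv_const]
  refine ⟨partialDeriv 0 F 0, F 0, fun x => ?_⟩
  rw [eq_affine_of_partialDeriv_partialDeriv_eq_zero hF hsecond x]
  simp [Fin.sum_univ_four, hF1, hF2, hF3, add_comm]

theorem partialDeriv_mul_of_dependsOn_zero {c : ℝ → ℝ} {Q : R4 → ℝ} (hc : Differentiable ℝ c)
    (hQ : Differentiable ℝ Q) {i : Fin 4} (hi : i ≠ 0) (x : R4) :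
    partialDeriv i (fun y => c (y 0) * Q y) x = c (x 0) * partialDeriv i Q x := by
  rw [partialDeriv_mul (by fun_prop) (by fun_prop), partialDeriv_comp (hc _) (by fun_prop),
    partialDeriv_coord, if_neg hi.symm]
  ring

theorem HessianEqDuSq.transverse_system {hw : ContDiff ℝ ∞ w} {c : ℝ → ℝ} {P Q : R4 → ℝ}
    (h : HessianEqDuSq (planeWaveSpacetime w hw) P fun y => (1 / 2) * (c (y 0) * Q y))
    (hP : ContDiff ℝ ∞ P) (hQ : Differentiable ℝ Q) (hc : Differentiable ℝ c)
    (hw0 : ∀ u, w u ≠ 0) (x : R4) :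
    c (x 0) * partialDeriv 2 Q x = w (x 0) * partialDeriv 3 P x ∧
      c (x 0) * partialDeriv 3 Q x = w (x 0) * partialDeriv 2 P x := by
  have h2 := h.partialDeriv_two_source hP (by fun_prop) hw0 x
  have h3 := h.partialDeriv_three_source hP (by fun_prop) hw0 x
  rw [partialDeriv_const_mul _ (by fun_prop),
    partialDeriv_mul_of_dependsOn_zero hc hQ (by decide)] at h2 h3
  exact ⟨by linarith, by linarith⟩

theorem exists_abs_profile_eq (hw₁ : ContDiff ℝ ∞ w₁) (hw₂ : ContDiff ℝ ∞ w₂)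
    (hw0 : ∀ u, w₁ u ≠ 0) {φ : R4 → R4} (hφ : ∀ ρ, ContDiff ℝ ∞ fun y => φ y ρ)
    (h : IsPullback φ (planeWaveSpacetime w₂ hw₂) (planeWaveSpacetime w₁ hw₁)) :
    ∃ a b : ℝ, ∀ u, |w₁ u| = a ^ 2 * |w₂ (a * u + b)| := by
  have hdw₂ : Differentiable ℝ w₂ := hw₂.differentiable (by norm_num)
  have hdφ : ∀ ρ, Differentiable ℝ fun y => φ y ρ :=
    fun ρ => (hφ ρ).differentiable (by norm_num)
  have hv := partialDeriv_brinkmannProfile hdw₂ 1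
  obtain ⟨a, b, hφ0⟩ := exists_affine_of_hessianEqDuSq_zero
    (h.hessianEqDuSq_apply_zero hφ hv) (hφ 0) hw0
  refine ⟨a, b, fun u => ?_⟩
  let c : ℝ → ℝ := fun u => a ^ 2 * w₂ (a * u + b)
  have hc : Differentiable ℝ c := by fun_prop
  have hP : HessianEqDuSq (planeWaveSpacetime w₁ hw₁) (fun y => φ y 2)
      fun y => (1 / 2) * (c (y 0) * φ y 3) := by
    simpa [partialDeriv_brinkmannProfile hdw₂, hφ0, c, mul_assoc] using
      h.hessianEqDuSq_apply hφ hv hφ0 (.inl rfl)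
  have hQ : HessianEqDuSq (planeWaveSpacetime w₁ hw₁) (fun y => φ y 3)
      fun y => (1 / 2) * (c (y 0) * φ y 2) := by
    simpa [partialDeriv_brinkmannProfile hdw₂, hφ0, c, mul_assoc] using
      h.hessianEqDuSq_apply hφ hv hφ0 (.inr rfl)
  obtain ⟨hP₃, hP₂⟩ := hP.transverse_system (hφ 2) (hdφ 3) hc hw0 (Pi.single 0 u)
  obtain ⟨hQ₃, hQ₂⟩ := hQ.transverse_system (hφ 3) (hdφ 2) hc hw0 (Pi.single 0 u)
  have hnorm := h.sq_add_sq_eq_metric hφ0 (i := 2) (by decide) (Pi.single 0 u)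
  have hsq : w₁ u ^ 2 = c u ^ 2 := by
    simp only [Pi.single_eq_same] at hP₂ hP₃ hQ₂ hQ₃
    have hmetric : (planeWaveSpacetime w₁ hw₁).metric (Pi.single 0 u) 2 2 = 1 := rfl
    rw [hmetric] at hnorm
    set P₂ := partialDeriv 2 (fun y => φ y 2) (Pi.single 0 u)
    set Q₂ := partialDeriv 2 (fun y => φ y 3) (Pi.single 0 u)
    linear_combination (-(w₁ u ^ 2 - c u ^ 2)) * hnorm - P₂ * (w₁ u * hP₂ + c u * hQ₃) -
      Q₂ * (c u * hP₃ + w₁ u * hQ₂)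
  rw [(sq_eq_sq_iff_abs_eq_abs _ _).1 hsq, abs_mul, abs_sq]

theorem exists_profile_eq_of_diffEquivalent (hw₁ : ContDiff ℝ ∞ w₁) (hw₂ : ContDiff ℝ ∞ w₂)
    (pos₁ : ∀ u, 0 < w₁ u) (pos₂ : ∀ u, 0 < w₂ u)
    (h : DiffEquivalent (planeWaveSpacetime w₂ hw₂) (planeWaveSpacetime w₁ hw₁)) :
    ∃ a b : ℝ, ∀ u, w₁ u = a ^ 2 * w₂ (a * u + b) := by
  obtain ⟨φ, hφ⟩ := diffEquivalent_iff_exists_isPullback.1 h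
  simpa only [abs_of_pos (pos₁ _), abs_of_pos (pos₂ _)] using exists_abs_profile_eq hw₁ hw₂
    (fun u => (pos₁ u).ne') (contDiff_pi.1 φ.contMDiff.contDiff) hφ

end PlaneWave

/-! ### Pulse trains -/

namespace IsBellCurve

variable {W : ℝ → ℝ} {x y : ℝ}

theorem eq_zero_of_nonpos (hW : IsBellCurve W) (hx : x ≤ 0) : W x = 0 := by
  have hclosed : IsClosed {x | W x = 0} := isClosed_eq hW.smooth.continuous continuous_const
  have hIio : Set.Iio 0 ⊆ {x | W x = 0} := fun x hx => hW.eq_zero x fun h => h.1.not_gt hx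
  exact hclosed.closure_subset_iff.2 hIio (closure_Iio (0 : ℝ) ▸ hx)

theorem eq_zero_of_one_le (hW : IsBellCurve W) (hx : 1 ≤ x) : W x = 0 := by
  have hclosed : IsClosed {x | W x = 0} := isClosed_eq hW.smooth.continuous continuous_const
  have hIoi : Set.Ioi 1 ⊆ {x | W x = 0} := fun x hx => hW.eq_zero x fun h => h.2.not_gt hx
  exact hclosed.closure_subset_iff.2 hIoi (closure_Ioi (1 : ℝ) ▸ hx)

theorem pos_of_apply_eq_one (hW : IsBellCurve W) (hx : W x = 1) : 0 < x := by
  by_contra! hx0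
  simp [hW.eq_zero_of_nonpos hx0] at hx

theorem lt_half_of_apply_eq_one (hW : IsBellCurve W) (hx : W x = 1) : x < 1 / 2 := by
  obtain ⟨x₀, hx₀, -, huniq⟩ := hW.peak
  rwa [huniq x hx]

theorem eq_of_apply_eq_one (hW : IsBellCurve W) (hx : W x = 1) (hy : W y = 1) : x = y := by
  obtain ⟨x₀, -, -, huniq⟩ := hW.peak
  rw [huniq x hx, huniq y hy]

end IsBellCurve

/-- The sign `±1` with which `W` enters a pulse train on an interval whose label is `b`. -/
def pulseSign (b : Bool) : ℝ := if b = true then 1 else -1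

theorem pulseSign_injective : Function.Injective pulseSign := by
  intro b c h
  cases b <;> cases c <;> first | rfl | norm_num [pulseSign] at h

theorem abs_pulseSign (b : Bool) : |pulseSign b| = 1 := by
  cases b <;> simp [pulseSign]

theorem pulseSign_ne_zero (b : Bool) : pulseSign b ≠ 0 :=
  abs_pos.1 (by rw [abs_pulseSign]; exact one_pos)

theorem pulseSign_eq_neg_of_ne {b c : Bool} (h : b ≠ c) : pulseSign b = -pulseSign c := by
  cases b <;> cases c <;> first | exact absurd rfl h | norm_num [pulseSign]

theorem pulseTrain_eq (W : ℝ → ℝ) (α : BernoulliSpace) (u : ℝ) :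
    pulseTrain W α u = 2 + pulseSign (α ⌊u⌋) * W (Int.fract u) := by
  unfold pulseTrain pulseSign
  rw [Int.self_sub_floor]
  split_ifs <;> ring

theorem pulseTrain_intCast_add (W : ℝ → ℝ) (α : BernoulliSpace) (n : ℤ) {t : ℝ} (ht0 : 0 ≤ t)
    (ht1 : t < 1) : pulseTrain W α (n + t) = 2 + pulseSign (α n) * W t := by
  have hfloor : ⌊(n : ℝ) + t⌋ = n := Int.floor_eq_iff.2 ⟨by linarith, by linarith⟩
  rw [pulseTrain_eq, Int.fract, hfloor, add_sub_cancel_left]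

theorem pulseTrain_smul (W : ℝ → ℝ) (k : Multiplicative ℤ) (α : BernoulliSpace) (u : ℝ) :
    pulseTrain W (k • α) u = pulseTrain W α (u - k.toAdd) := by
  have hsmul : (k • α) ⌊u⌋ = α (⌊u⌋ - k.toAdd) := rfl
  rw [pulseTrain_eq, pulseTrain_eq, hsmul, Int.floor_sub_intCast, Int.fract_sub_intCast]

section PulseTrain

variable {W : ℝ → ℝ} {α β : BernoulliSpace} {x₀ : ℝ}

theorem pulseTrain_eq_add (hW : IsBellCurve W) (α : BernoulliSpace) (n : ℤ) {t : ℝ}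
    (ht : t ∈ Set.Ioo (-1) 1) :
    pulseTrain W α (n + t) =
      2 + pulseSign (α (n - 1)) * W (t + 1) + pulseSign (α n) * W t := by
  rcases lt_or_ge t 0 with ht0 | ht0
  · have hprev := pulseTrain_intCast_add W α (n - 1) (t := t + 1) (by linarith [ht.1])
      (by linarith)
    rw [show (n : ℝ) + t = (n - 1 : ℤ) + (t + 1) by push_cast; ring, hprev,
      hW.eq_zero_of_nonpos ht0.le, mul_zero, add_zero]
  · rw [pulseTrain_intCast_add W α n ht0 ht.2, hW.eq_zero_of_one_le (x := t + 1) (by linarith),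
      mul_zero, add_zero]

theorem contDiff_pulseTrain (hW : IsBellCurve W) (α : BernoulliSpace) :
    ContDiff ℝ ∞ (pulseTrain W α) := by
  have hsmooth := hW.smooth
  refine contDiff_iff_contDiffAt.2 fun u => ContDiffAt.congr_of_eventuallyEq
    (f := fun t => 2 + pulseSign (α (⌊u⌋ - 1)) * W (t - ⌊u⌋ + 1) +
      pulseSign (α ⌊u⌋) * W (t - ⌊u⌋)) (by fun_prop) ?_
  filter_upwards [Ioo_mem_nhds (show (⌊u⌋ : ℝ) - 1 < u by linarith [Int.floor_le u])
    (Int.lt_floor_add_one u)] with t ht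
  rw [← pulseTrain_eq_add hW α ⌊u⌋ ⟨by linarith [ht.1], by linarith [ht.2]⟩, add_sub_cancel]

theorem pulseTrain_mem_Icc (hW : IsBellCurve W) (α : BernoulliSpace) (u : ℝ) :
    pulseTrain W α u ∈ Set.Icc 1 3 := by
  have hW' := hW.mem_Icc (Int.fract u)
  have hdist : |pulseSign (α ⌊u⌋) * W (Int.fract u)| ≤ 1 := by
    rw [abs_mul, abs_pulseSign, one_mul, abs_of_nonneg hW'.1]
    exact hW'.2
  rw [pulseTrain_eq]
  constructor <;> linarith [abs_le.1 hdist]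

theorem pulseTrain_zero (hW : IsBellCurve W) (α : BernoulliSpace) : pulseTrain W α 0 = 2 := by
  simpa [hW.eq_zero_of_nonpos le_rfl] using pulseTrain_intCast_add W α 0 le_rfl zero_lt_one

theorem pulseTrain_add_peak (hW : IsBellCurve W) (hx₀ : W x₀ = 1) (α : BernoulliSpace) (n : ℤ) :
    pulseTrain W α (n + x₀) = 2 + pulseSign (α n) := by
  rw [pulseTrain_intCast_add W α n (hW.pos_of_apply_eq_one hx₀).le
    (by linarith [hW.lt_half_of_apply_eq_one hx₀]), hx₀, mul_one]

theorem fract_eq_of_pulseTrain_eq (hW : IsBellCurve W) (hx₀ : W x₀ = 1) {u : ℝ} {b : Bool}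
    (h : pulseTrain W α u = 2 + pulseSign b) : Int.fract u = x₀ := by
  rw [pulseTrain_eq, add_right_inj] at h
  have habs := congrArg abs h
  rw [abs_mul, abs_pulseSign, abs_pulseSign, one_mul, abs_of_nonneg (hW.mem_Icc _).1] at habs
  exact hW.eq_of_apply_eq_one habs hx₀

theorem isGreatest_range_pulseTrain_of_eq_true (hW : IsBellCurve W) {n : ℤ} (hn : α n = true) :
    IsGreatest (Set.range (pulseTrain W α)) 3 := by
  obtain ⟨x₀, -, hx₀, -⟩ := hW.peak
  refine ⟨⟨n + x₀, ?_⟩, Set.forall_mem_range.2 fun u => (pulseTrain_mem_Icc hW α u).2⟩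
  norm_num [pulseTrain_add_peak hW hx₀, hn, pulseSign]

theorem isLeast_range_pulseTrain_of_eq_false (hW : IsBellCurve W) {n : ℤ} (hn : α n = false) :
    IsLeast (Set.range (pulseTrain W α)) 1 := by
  obtain ⟨x₀, -, hx₀, -⟩ := hW.peak
  refine ⟨⟨n + x₀, ?_⟩, Set.forall_mem_range.2 fun u => (pulseTrain_mem_Icc hW α u).1⟩
  norm_num [pulseTrain_add_peak hW hx₀, hn, pulseSign]

theorem isLeast_range_pulseTrain_of_forall_eq_true (hW : IsBellCurve W) (hα : ∀ n, α n = true) :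
    IsLeast (Set.range (pulseTrain W α)) 2 := by
  refine ⟨⟨0, pulseTrain_zero hW α⟩, Set.forall_mem_range.2 fun u => ?_⟩
  simp [pulseTrain_eq, hα, pulseSign, (hW.mem_Icc _).1]

theorem isGreatest_range_pulseTrain_of_forall_eq_false (hW : IsBellCurve W)
    (hα : ∀ n, α n = false) : IsGreatest (Set.range (pulseTrain W α)) 2 := by
  refine ⟨⟨0, pulseTrain_zero hW α⟩, Set.forall_mem_range.2 fun u => ?_⟩
  simp [pulseTrain_eq, hα, pulseSign, (hW.mem_Icc _).1]

theorem exists_isGreatest_isLeast_range_pulseTrain (hW : IsBellCurve W) (α : BernoulliSpace) :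
    ∃ M m : ℝ, IsGreatest (Set.range (pulseTrain W α)) M ∧
      IsLeast (Set.range (pulseTrain W α)) m ∧
      ((M = 3 ∧ m = 1) ∨ (M = 3 ∧ m = 2) ∨ (M = 2 ∧ m = 1)) := by
  by_cases htrue : ∀ n, α n = true
  · exact ⟨3, 2, isGreatest_range_pulseTrain_of_eq_true hW (htrue 0),
      isLeast_range_pulseTrain_of_forall_eq_true hW htrue, by norm_num⟩
  by_cases hfalse : ∀ n, α n = false
  · exact ⟨2, 1, isGreatest_range_pulseTrain_of_forall_eq_false hW hfalse,
      isLeast_range_pulseTrain_of_eq_false hW (hfalse 0), by norm_num⟩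
  push Not at htrue hfalse
  obtain ⟨m, hm⟩ := htrue
  obtain ⟨n, hn⟩ := hfalse
  exact ⟨3, 1, isGreatest_range_pulseTrain_of_eq_true hW (Bool.eq_true_of_not_eq_false hn),
    isLeast_range_pulseTrain_of_eq_false hW (Bool.eq_false_of_not_eq_true hm), by norm_num⟩

/-- The ratio of the maximum to the minimum of a pulse train is `3`, `3/2` or `2`, and it determines
both, so that a rescaling of the values by `a²` must be trivial. -/
theorem sq_eq_one_of_pulseTrain_eq (hW : IsBellCurve W) {a b : ℝ}
    (h : ∀ u, pulseTrain W β u = a ^ 2 * pulseTrain W α (a * u + b)) : a ^ 2 = 1 := by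
  have ha : a ≠ 0 := by
    rintro rfl
    have hzero := h 0
    norm_num [pulseTrain_zero hW] at hzero
  have hsurj : Function.Surjective fun u => a * u + b := fun v => ⟨(v - b) / a, by field_simp; ring⟩
  have hrange : Set.range (pulseTrain W β) = (a ^ 2 * ·) '' Set.range (pulseTrain W α) := by
    rw [← Set.range_comp, funext h]
    exact hsurj.range_comp fun v => a ^ 2 * pulseTrain W α v
  have hmono : Monotone (a ^ 2 * · : ℝ → ℝ) := monotone_mul_left_of_nonneg (sq_nonneg a)
  obtain ⟨M, m, hM, hm, hα⟩ := exists_isGreatest_isLeast_range_pulseTrain hW α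
  obtain ⟨M', m', hM', hm', hβ⟩ := exists_isGreatest_isLeast_range_pulseTrain hW β
  rw [hrange] at hM' hm'
  have hmax := hM'.unique (hmono.map_isGreatest hM)
  have hmin := hm'.unique (hmono.map_isLeast hm)
  rcases hα with ⟨rfl, rfl⟩ | ⟨rfl, rfl⟩ | ⟨rfl, rfl⟩ <;>
    rcases hβ with ⟨rfl, rfl⟩ | ⟨rfl, rfl⟩ | ⟨rfl, rfl⟩ <;> linarith

theorem exists_eq_apply_add_of_pulseTrain_eq (hW : IsBellCurve W) {b : ℝ}
    (h : ∀ u, pulseTrain W β u = pulseTrain W α (u + b)) : ∃ m : ℤ, ∀ n, β n = α (n + m) := by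
  obtain ⟨x₀, -, hx₀, -⟩ := hW.peak
  have hpeak (n : ℤ) := (h (n + x₀)).symm.trans (pulseTrain_add_peak hW hx₀ β n)
  have hb : b = ⌊x₀ + b⌋ := by
    have hfract := fract_eq_of_pulseTrain_eq hW hx₀ (hpeak 0)
    rw [Int.cast_zero, zero_add] at hfract
    linarith [Int.floor_add_fract (x₀ + b)]
  refine ⟨⌊x₀ + b⌋, fun n => pulseSign_injective ?_⟩
  have hn := hpeak n
  rw [show (n : ℝ) + x₀ + b = (n + ⌊x₀ + b⌋ : ℤ) + x₀ by push_cast; linarith,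
    pulseTrain_add_peak hW hx₀] at hn
  linarith

theorem exists_eq_apply_sub_of_pulseTrain_eq (hW : IsBellCurve W) (hx₀ : W x₀ = 1) {b : ℝ}
    (h : ∀ u, pulseTrain W β u = pulseTrain W α (b - u)) :
    ∃ m : ℤ, b = m + 2 * x₀ ∧ ∀ n, β n = α (m - n) := by
  have hpeak (n : ℤ) := (h (n + x₀)).symm.trans (pulseTrain_add_peak hW hx₀ β n)
  have hb : b = ⌊b - x₀⌋ + 2 * x₀ := by
    have hfract := fract_eq_of_pulseTrain_eq hW hx₀ (hpeak 0)
    rw [Int.cast_zero, zero_add] at hfract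
    linarith [Int.floor_add_fract (b - x₀)]
  refine ⟨⌊b - x₀⌋, hb, fun n => pulseSign_injective ?_⟩
  have hn := hpeak n
  rw [show b - (n + x₀) = (⌊b - x₀⌋ - n : ℤ) + x₀ by push_cast; linarith,
    pulseTrain_add_peak hW hx₀] at hn
  linarith

section Reflection

variable {m : ℤ} (hW : IsBellCurve W) (hx₀ : W x₀ = 1)
  (h : ∀ u, pulseTrain W β u = pulseTrain W α (m + 2 * x₀ - u)) (hm : ∀ n, β n = α (m - n))
include hW hx₀ h hm

theorem apply_eq_apply_two_mul_sub_of_reflection {t : ℝ} (ht : t ∈ Set.Icc 0 (2 * x₀)) :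
    W t = W (2 * x₀ - t) := by
  have hhalf := hW.lt_half_of_apply_eq_one hx₀
  have hu := h ((0 : ℤ) + t)
  rw [pulseTrain_intCast_add W β 0 ht.1 (by linarith [ht.2]),
    show (m : ℝ) + 2 * x₀ - ((0 : ℤ) + t) = m + (2 * x₀ - t) by push_cast; ring,
    pulseTrain_intCast_add W α m (by linarith [ht.2]) (by linarith [ht.1]), hm, sub_zero,
    add_right_inj] at hu
  exact mul_left_cancel₀ (pulseSign_ne_zero _) hu

theorem apply_eq_zero_of_reflection_of_ne {j : ℤ} (hj : α j ≠ α (j - 1)) {t : ℝ}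
    (ht : 2 * x₀ < t) : W t = 0 := by
  have hpos := hW.pos_of_apply_eq_one hx₀
  rcases le_or_gt 1 t with ht1 | ht1
  · exact hW.eq_zero_of_one_le ht1
  have hu := h ((m - j : ℤ) + t)
  rw [pulseTrain_intCast_add W β _ (by linarith) ht1,
    show (m : ℝ) + 2 * x₀ - ((m - j : ℤ) + t) = (j - 1 : ℤ) + (2 * x₀ + 1 - t) by
      push_cast; ring,
    pulseTrain_intCast_add W α _ (by linarith) (by linarith), hm, sub_sub_cancel,
    pulseSign_eq_neg_of_ne hj] at hu
  have hsum : pulseSign (α (j - 1)) * (W t + W (2 * x₀ + 1 - t)) = 0 := by linarith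
  have hcancel := (mul_eq_zero.1 hsum).resolve_left (pulseSign_ne_zero _)
  linarith [(hW.mem_Icc t).1, (hW.mem_Icc (2 * x₀ + 1 - t)).1]

theorem apply_eq_apply_sub_one_of_reflection (j : ℤ) : α j = α (j - 1) := by
  by_contra hj
  have htail {t : ℝ} (ht : 2 * x₀ < t) := apply_eq_zero_of_reflection_of_ne hW hx₀ h hm hj ht
  have hsymm (t : ℝ) : W t = W (2 * x₀ - t) := by
    rcases lt_or_ge t 0 with ht0 | ht0
    · rw [hW.eq_zero_of_nonpos ht0.le, htail (by linarith)]
    rcases lt_or_ge (2 * x₀) t with ht | ht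
    · rw [htail ht, hW.eq_zero_of_nonpos (by linarith)]
    exact apply_eq_apply_two_mul_sub_of_reflection hW hx₀ h hm ⟨ht0, ht⟩
  obtain ⟨t, ht⟩ := hW.asymmetric x₀
  exact ht (by rw [hsymm]; congr 1; ring)

end Reflection

theorem mem_orbit_of_forall_eq_apply_add {m : ℤ} (h : ∀ n, β n = α (n + m)) :
    β ∈ MulAction.orbit (Multiplicative ℤ) α := by
  refine ⟨Multiplicative.ofAdd (-m), funext fun n => ?_⟩
  change α (n - -m) = β n
  rw [h, sub_neg_eq_add]

theorem mem_orbit_of_pulseTrain_eq (hW : IsBellCurve W) {a b : ℝ}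
    (h : ∀ u, pulseTrain W β u = a ^ 2 * pulseTrain W α (a * u + b)) :
    β ∈ MulAction.orbit (Multiplicative ℤ) α := by
  have ha := sq_eq_one_of_pulseTrain_eq hW h
  simp only [ha, one_mul] at h
  rcases sq_eq_one_iff.1 ha with rfl | rfl
  · obtain ⟨m, hm⟩ := exists_eq_apply_add_of_pulseTrain_eq hW (by simpa only [one_mul] using h)
    exact mem_orbit_of_forall_eq_apply_add hm
  · obtain ⟨x₀, -, hx₀, -⟩ := hW.peak
    simp only [neg_one_mul, neg_add_eq_sub] at h
    obtain ⟨m, rfl, hm⟩ := exists_eq_apply_sub_of_pulseTrain_eq hW hx₀ h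
    have hperiodic : Function.Periodic (α : ℤ → Bool) 1 := fun n => by
      simpa using apply_eq_apply_sub_one_of_reflection hW hx₀ h hm (n + 1)
    have hconst (n : ℤ) : α n = α 0 := by simpa using hperiodic.int_mul_eq n
    refine mem_orbit_of_forall_eq_apply_add (m := 0) fun n => ?_
    rw [hm, hconst, hconst (n + 0)]

end PulseTrain

/-! ### Generic ergodicity of the Bernoulli shift -/

theorem isMeagre_of_countable {X : Type*} [TopologicalSpace X] [T1Space X] [PerfectSpace X]
    {s : Set X} (hs : s.Countable) : IsMeagre s := by
  rw [← Set.biUnion_of_singleton s]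
  refine isMeagre_biUnion hs fun x _ => IsNowhereDense.isMeagre ?_
  rw [isClosed_singleton.isNowhereDense_iff, interior_singleton]

theorem exists_dense_orbit_of_isTopologicallyTransitive (M X : Type*) [Monoid M]
    [TopologicalSpace X] [MulAction M X] [ContinuousConstSMul M X]
    [MulAction.IsTopologicallyTransitive M X] [BaireSpace X] [SecondCountableTopology X]
    [Nonempty X] : ∃ x : X, Dense (MulAction.orbit M x) := by
  have hbasis := TopologicalSpace.isBasis_countableBasis X
  have hdense : Dense (⋂ U ∈ TopologicalSpace.countableBasis X, ⋃ m : M, (m • ·) ⁻¹' U) :=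
    dense_biInter_of_isOpen
      (fun U hU => isOpen_iUnion fun m => (hbasis.isOpen hU).preimage (continuous_const_smul m))
      (TopologicalSpace.countable_countableBasis X) fun U hU =>
        (hbasis.isOpen hU).dense_iUnion_preimage_smul M
          (TopologicalSpace.nonempty_of_mem_countableBasis hU)
  obtain ⟨x, hx⟩ := hdense.nonempty
  refine ⟨x, hbasis.dense_iff.2 fun U hU _ => ?_⟩
  obtain ⟨m, hm⟩ := Set.mem_iUnion.1 (Set.mem_iInter₂.1 hx U hU)
  exact ⟨m • x, hm, m, rfl⟩

theorem exists_finset_of_mem_nhds_pi {ι : Type*} {X : ι → Type*} [∀ i, TopologicalSpace (X i)]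
    {f : ∀ i, X i} {s : Set (∀ i, X i)} (hs : s ∈ nhds f) :
    ∃ I : Finset ι, ∀ g : ∀ i, X i, (∀ i ∈ I, g i = f i) → g ∈ s := by
  rw [nhds_pi, Filter.mem_pi'] at hs
  obtain ⟨I, t, ht, hI⟩ := hs
  refine ⟨I, fun g hg => hI fun i hi => ?_⟩
  rw [hg i hi]
  exact mem_of_mem_nhds (ht i)

instance perfectSpace_pi {ι : Type*} [Infinite ι] {X : ι → Type*} [∀ i, TopologicalSpace (X i)]
    [∀ i, Nontrivial (X i)] : PerfectSpace (∀ i, X i) := by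
  classical
  refine perfectSpace_iff_forall_not_isolated.2 fun f => ?_
  rw [← mem_closure_iff_nhdsWithin_neBot, mem_closure_iff_nhds]
  intro s hs
  obtain ⟨I, hI⟩ := exists_finset_of_mem_nhds_pi hs
  obtain ⟨i, hi⟩ := Infinite.exists_notMem_finset I
  obtain ⟨a, ha⟩ := exists_ne (f i)
  exact ⟨Function.update f i a,
    hI _ fun j hj => Function.update_of_ne (ne_of_mem_of_not_mem hj hi) _ _,
    Function.update_ne_self_iff.2 ha⟩

namespace BernoulliSpace

instance : PolishSpace BernoulliSpace :=
  ({} : PolishSpace (ℤ → Bool))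

instance : PerfectSpace BernoulliSpace := inferInstanceAs (PerfectSpace (ℤ → Bool))

instance : Nonempty BernoulliSpace := ⟨fun _ => true⟩

theorem continuous_eval (n : ℤ) : Continuous fun α : BernoulliSpace => α n :=
  continuous_apply (A := fun _ : ℤ => Bool) n

instance : ContinuousSMul (Multiplicative ℤ) BernoulliSpace :=
  ⟨continuous_prod_of_discrete_left.2 fun k =>
    continuous_pi fun n => continuous_eval (n - k.toAdd)⟩

open scoped Pointwise in
instance : MulAction.IsTopologicallyTransitive (Multiplicative ℤ) BernoulliSpace := by
  refine (MulAction.isTopologicallyTransitive_iff _).2 fun {U V} hU ⟨α, hα⟩ hV ⟨β, hβ⟩ => ?_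
  obtain ⟨I, hI⟩ := exists_finset_of_mem_nhds_pi (X := fun _ : ℤ => Bool) (hU.mem_nhds hα)
  obtain ⟨J, hJ⟩ := exists_finset_of_mem_nhds_pi (X := fun _ : ℤ => Bool) (hV.mem_nhds hβ)
  obtain ⟨k, hk⟩ := Infinite.exists_notMem_finset (J - I)
  let γ : BernoulliSpace := fun n => if n ∈ I then α n else β (n + k)
  refine ⟨Multiplicative.ofAdd k, _, Set.smul_mem_smul_set (hI γ fun n hn => if_pos hn),
    hJ _ fun n hn => ?_⟩
  have hnk : n - k ∉ I := fun h => hk (Finset.mem_sub.2 ⟨n, hn, n - k, h, sub_sub_cancel n k⟩)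
  change γ (n - k) = β n
  rw [show γ (n - k) = β (n - k + k) from if_neg hnk, sub_add_cancel]

end BernoulliSpace

theorem isPolishGSpace_bernoulliSpace :
    IsPolishGSpace (Multiplicative ℤ) BernoulliSpace where
  topologicalGroup := inferInstance
  polishGroup := inferInstance
  polishSpace := inferInstance
  continuous_smul := inferInstance

theorem isGenericallyErgodic_bernoulliSpace :
    IsGenericallyErgodic (Multiplicative ℤ) BernoulliSpace where
  toIsPolishGSpace := isPolishGSpace_bernoulliSpace
  exists_dense_orbit := exists_dense_orbit_of_isTopologicallyTransitive _ _
  meager_orbit _ := isMeagre_of_countable (Set.countable_range _)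

/-! ### Continuity of families of spacetimes -/

theorem continuous_of_forall_isCompact_eventuallyEq {X : Type*} [TopologicalSpace X]
    {f : X → Spacetime} (h : ∀ α, ∀ K : Set R4, IsCompact K →
      ∀ᶠ β in nhds α, ∀ x ∈ K, (f β).metric =ᶠ[nhds x] (f α).metric) : Continuous f := by
  refine continuous_iInf_rng.2 fun n => continuous_induced_rng.2 ?_
  refine continuous_iff_continuousAt.2 fun α => ?_
  refine ContinuousMap.tendsto_iff_forall_isCompact_tendstoUniformlyOn.2 fun K hK U hU => ?_
  filter_upwards [h α K hK] with β hβ x hx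
  have hjet : Spacetime.jet n (f β) x = Spacetime.jet n (f α) x :=
    ((hβ x hx).iteratedFDeriv ℝ n).eq_of_nhds
  simp only [Function.comp_apply, hjet]
  exact refl_mem_uniformity hU

theorem BernoulliSpace.eventually_forall_eq (α : BernoulliSpace) {s : Set ℤ} (hs : s.Finite) :
    ∀ᶠ β : BernoulliSpace in nhds α, ∀ n ∈ s, β n = α n :=
  (Filter.eventually_all_finite hs).2 fun n _ =>
    (BernoulliSpace.continuous_eval n).continuousAt.eventually
      ((isOpen_discrete {α n}).mem_nhds rfl)

theorem eventually_forall_pulseTrain_eq (W : ℝ → ℝ) (α : BernoulliSpace) (R : ℝ) :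
    ∀ᶠ β in nhds α, ∀ u, |u| < R → pulseTrain W β u = pulseTrain W α u := by
  filter_upwards [BernoulliSpace.eventually_forall_eq α (Set.finite_Icc ⌊-R⌋ ⌊R⌋)] with β hβ u hu
  have hu := abs_lt.1 hu
  rw [pulseTrain_eq, pulseTrain_eq,
    hβ ⌊u⌋ ⟨Int.floor_mono hu.1.le, Int.floor_mono hu.2.le⟩]

/-! ### A bell curve -/

/-- The bell curve `exp (-(1 - 3x)² / (x (1 - x)))` on `(0,1)`, with peak at `1/3`. Since
`(1 - 3x)² / (x (1 - x)) = 1 / x + 4 / (1 - x) - 9`, it is a product of functions `exp (-1 / t)`. -/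
noncomputable def bellCurve (x : ℝ) : ℝ :=
  Real.exp 9 * (expNegInvGlue x * expNegInvGlue ((1 - x) / 4))

section BellCurve

variable {x : ℝ}

theorem contDiff_bellCurve : ContDiff ℝ ∞ bellCurve := by
  have : ContDiff ℝ ∞ expNegInvGlue := expNegInvGlue.contDiff
  unfold bellCurve
  fun_prop

theorem bellCurve_of_notMem_Ioo (hx : x ∉ Set.Ioo 0 1) : bellCurve x = 0 := by
  rw [bellCurve]
  rcases le_or_gt x 0 with hx0 | hx0
  · rw [expNegInvGlue.zero_of_nonpos hx0, zero_mul, mul_zero]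
  · have hx1 : 1 ≤ x := not_lt.1 fun hx1 => hx ⟨hx0, hx1⟩
    rw [expNegInvGlue.zero_of_nonpos (x := (1 - x) / 4) (by linarith), mul_zero, mul_zero]

theorem bellCurve_of_mem_Ioo (hx : x ∈ Set.Ioo 0 1) :
    bellCurve x = Real.exp (-((1 - 3 * x) ^ 2 / (x * (1 - x)))) := by
  have hx0 : 0 < x := hx.1
  have hx1 : 0 < 1 - x := sub_pos.2 hx.2
  rw [bellCurve, expNegInvGlue, expNegInvGlue, if_neg hx0.not_ge, if_neg (by linarith),
    ← Real.exp_add, ← Real.exp_add]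
  congr 1
  field_simp
  ring

theorem bellCurve_eq_one_iff : bellCurve x = 1 ↔ x = 1 / 3 := by
  constructor
  · intro h
    have hx : x ∈ Set.Ioo 0 1 := by
      by_contra hx
      exact zero_ne_one ((bellCurve_of_notMem_Ioo hx).symm.trans h)
    have hden : x * (1 - x) ≠ 0 := (mul_pos hx.1 (sub_pos.2 hx.2)).ne'
    rw [bellCurve_of_mem_Ioo hx, Real.exp_eq_one_iff, neg_eq_zero, div_eq_zero_iff,
      or_iff_left hden, sq_eq_zero_iff] at h
    linarith
  · rintro rfl
    rw [bellCurve_of_mem_Ioo (by norm_num)]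
    norm_num

theorem bellCurve_mem_Icc (x : ℝ) : bellCurve x ∈ Set.Icc 0 1 := by
  by_cases hx : x ∈ Set.Ioo 0 1
  · have hquot : 0 ≤ (1 - 3 * x) ^ 2 / (x * (1 - x)) :=
      div_nonneg (sq_nonneg _) (mul_pos hx.1 (sub_pos.2 hx.2)).le
    rw [bellCurve_of_mem_Ioo hx]
    exact ⟨(Real.exp_pos _).le, Real.exp_le_one_iff.2 (neg_nonpos.2 hquot)⟩
  · rw [bellCurve_of_notMem_Ioo hx]
    exact Set.left_mem_Icc.2 zero_le_one

theorem exists_bellCurve_add_ne_bellCurve_sub (c : ℝ) :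
    ∃ t, bellCurve (c + t) ≠ bellCurve (c - t) := by
  by_contra! hsymm
  have hpeak : bellCurve (c - (1 / 3 - c)) = 1 := by
    rw [← hsymm, add_sub_cancel, bellCurve_eq_one_iff]
  obtain rfl : c = 1 / 3 := by linarith [bellCurve_eq_one_iff.1 hpeak]
  have hhalf := hsymm (1 / 2)
  rw [bellCurve_of_notMem_Ioo (x := 1 / 3 - 1 / 2) (by norm_num),
    bellCurve_of_mem_Ioo (by norm_num)] at hhalf
  exact (Real.exp_pos _).ne' hhalf

theorem isBellCurve_bellCurve : IsBellCurve bellCurve where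
  smooth := contDiff_bellCurve
  eq_zero _ hx := bellCurve_of_notMem_Ioo fun h => hx (Set.Ioo_subset_Icc_self h)
  mem_Icc := bellCurve_mem_Icc
  peak := ⟨1 / 3, by norm_num, bellCurve_eq_one_iff.2 rfl, fun _ => bellCurve_eq_one_iff.1⟩
  asymmetric := exists_bellCurve_add_ne_bellCurve_sub

end BellCurve

/-! ### The reduction -/

/-- The translation of `ℝ⁴` by `a`, as a diffeomorphism. -/
def translationDiffeomorph (a : R4) : Diffeomorph 𝓘(ℝ, R4) 𝓘(ℝ, R4) R4 R4 ∞ where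
  toEquiv := Equiv.addRight a
  contMDiff_toFun := (contDiff_id.add contDiff_const).contMDiff
  contMDiff_invFun := (contDiff_id.add contDiff_const).contMDiff

theorem diffEquivalent_of_metric_eq_metric_add {g' g : Spacetime} (a : R4)
    (h : ∀ x, g.metric x = g'.metric (x + a)) : DiffEquivalent g' g := by
  refine ⟨translationDiffeomorph a, fun x μ ν => ?_⟩
  have hjacobian (κ ρ : Fin 4) :
      partialDeriv κ (fun y => translationDiffeomorph a y ρ) x = if ρ = κ then 1 else 0 := by
    have hcoord : (fun y => translationDiffeomorph a y ρ) = fun y => 1 * y ρ + a ρ :=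
      funext fun y => by rw [one_mul]; rfl
    rw [hcoord, partialDeriv_mul_coord_add]
  have hpoint : translationDiffeomorph a x = x + a := rfl
  simp [hjacobian, hpoint, h]

section Reduction

variable {W : ℝ → ℝ} (hW : IsBellCurve W)

/-- The spacetime with metric `W_α(u) x y du² + du dv + dx² + dy²`. -/
noncomputable def pulseWave (α : BernoulliSpace) : Spacetime :=
  planeWaveSpacetime (pulseTrain W α) (contDiff_pulseTrain hW α)

theorem pulseWave_mem_vacuumSolutions (α : BernoulliSpace) :
    pulseWave hW α ∈ vacuumSolutions :=
  planeWaveSpacetime_mem_vacuumSolutions _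

theorem metric_pulseWave (α : BernoulliSpace) (p : R4) :
    (pulseWave hW α).metric p = planeWave (pulseTrain W α) p :=
  rfl

theorem continuous_pulseWave : Continuous (pulseWave hW) := by
  refine continuous_of_forall_isCompact_eventuallyEq fun α K hK => ?_
  obtain ⟨R, hR⟩ := (hK.image (continuous_apply (0 : Fin 4))).isBounded.exists_norm_le
  filter_upwards [eventually_forall_pulseTrain_eq W α (R + 1)] with β hβ x hx
  have hx0 : |x 0| < R + 1 := (hR _ ⟨x, hx, rfl⟩).trans_lt (lt_add_one R)
  have hcont : Continuous fun y : R4 => |y 0| := by fun_prop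
  filter_upwards [hcont.continuousAt.eventually_lt_const hx0] with y hy
  simp only [metric_pulseWave, planeWave, hβ _ hy]

theorem diffEquivalent_pulseWave_smul (k : Multiplicative ℤ) (α : BernoulliSpace) :
    DiffEquivalent (pulseWave hW α) (pulseWave hW (k • α)) :=
  diffEquivalent_of_metric_eq_metric_add (Pi.single 0 (-(k.toAdd : ℝ))) fun x => by
    simp [metric_pulseWave, planeWave, pulseTrain_smul, sub_eq_add_neg]

theorem mem_orbit_of_diffEquivalent_pulseWave {α β : BernoulliSpace}
    (h : DiffEquivalent (pulseWave hW α) (pulseWave hW β)) :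
    β ∈ MulAction.orbit (Multiplicative ℤ) α := by
  have hpos (γ : BernoulliSpace) (u : ℝ) : 0 < pulseTrain W γ u :=
    zero_lt_one.trans_le (pulseTrain_mem_Icc hW γ u).1
  obtain ⟨a, b, hab⟩ := exists_profile_eq_of_diffEquivalent (contDiff_pulseTrain hW β)
    (contDiff_pulseTrain hW α) (hpos β) (hpos α) h
  exact mem_orbit_of_pulseTrain_eq hW hab

/-- The pulse wave of a sequence, as a vacuum solution. -/
noncomputable def vacuumPulseWave (α : BernoulliSpace) : vacuumSolutions :=
  ⟨pulseWave hW α, pulseWave_mem_vacuumSolutions hW α⟩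

theorem continuous_vacuumPulseWave : Continuous (vacuumPulseWave hW) :=
  (continuous_pulseWave hW).subtype_mk _

theorem isBorelReduction_vacuumPulseWave :
    IsBorelReduction (Multiplicative ℤ) (vacuumPulseWave hW) where
  borel := (continuous_vacuumPulseWave hW).borel_measurable
  reduces α β := by
    rw [eq_comm, MulAction.orbit_eq_iff]
    refine ⟨?_, mem_orbit_of_diffEquivalent_pulseWave hW⟩
    rintro ⟨k, rfl⟩
    exact diffEquivalent_pulseWave_smul hW k α

end Reduction

theorem isRich_vacuumSolutions : IsRich vacuumSolutions :=
  ⟨Multiplicative ℤ, BernoulliSpace, inferInstance, inferInstance, inferInstance, inferInstance,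
    isGenericallyErgodic_bernoulliSpace, _, isBorelReduction_vacuumPulseWave isBellCurve_bellCurve⟩

theorem theorem3 :
    IsRich vacuumSolutions ∧
    IsGenericallyErgodic (Multiplicative ℤ) BernoulliSpace ∧
    (∃ W : ℝ → ℝ, IsBellCurve W) ∧
    ∀ W : ℝ → ℝ, IsBellCurve W →
      ∃ r : BernoulliSpace → vacuumSolutions,
        (∀ (α : BernoulliSpace) (p : R4),
          (r α : Spacetime).metric p = planeWave (pulseTrain W α) p) ∧
        Continuous r ∧
        IsBorelReduction (Multiplicative ℤ) r := by
  exact ⟨isRich_vacuumSolutions, isGenericallyErgodic_bernoulliSpace,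
    ⟨bellCurve, isBellCurve_bellCurve⟩, fun _ hW => ⟨vacuumPulseWave hW, metric_pulseWave hW,
      continuous_vacuumPulseWave hW, isBorelReduction_vacuumPulseWave hW⟩⟩
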